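/- All logarithms are to base 2, $S(p)=-p\log p-(1-p)\log(1-p)$ is the binary entropy, $S(\rho)=-\mathrm{Tr}\,\rho\log\rho$ the entropy of a quantum state, $I(A:B)=S(A)+S(B)-S(AB)$ the mutual information, and $\|A\|_1=\mathrm{Tr}\sqrt{A^\dagger A}$ the trace norm; a probability distribution on a finite set is viewed as a diagonal density matrix. The min-entropy of a distribution $P$ is $S_\infty(P)=-\log\max_i P(i)$. For $\epsilon\in(0,1/2)$, $k\in\mathbb R$ and finite nonempty sets $\mathcal X,\mathcal Y$, a function $h:\mathcal X\times\mathcal Y\to\{0,1\}$ is a strong $(k,\epsilon)$-extractor if for $Y$ uniform on $\mathcal Y$ and every random variable $X$ on $\mathcal X$ that is independent of $Y$ and has $S_\infty(X)\ge k$, one has $\|h(X,Y)Y-U\otimes Y\|_1<2\epsilon$, where $U$ is the uniform distribution on $\{0,1\}$. Theorem. Let $\epsilon\in(0,1/2)$, let $n,m\ge 0$ be integers and $k\in\mathbb R$, let $h:\{0,1\}^n\times\{0,1\}^m\to\{0,1\}$ be a strong $(k,\epsilon)$-extractor, and let $U$ be the uniform distribution on $\{0,1\}$. Let $YXM$ be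 a classical-quantum system in which $YX$ is classical and $M$ is a finite-dimensional quantum system, that is, its state is $\sum_{y,x}|y,x\rangle\langle y,x|\otimes\sigma_{y,x}$ with $\sigma_{y,x}\ge 0$ and $\sum_{y,x}\mathrm{Tr}\,\sigma_{y,x}=1$. Suppose that $X$ is uniformly distributed on $\{0,1\}^n$, and that $Y$ is uniformly distributed on $\{0,1\}^m$ and independent of $XM$ (the state of $YXM$ is the tensor product of the states of $Y$ and of $XM$). Put $$a(\epsilon)=\tfrac14\left(\tfrac12-\epsilon\right)^3,\qquad b(\epsilon)=\epsilon\left(S\left(\tfrac14-\tfrac{\epsilon}{2}\right)-S\left(\tfrac18-\tfrac{\epsilon}{4}\right)\right).$$ If $I(X:M)<b(\epsilon)\,(n-k)$, then $$\|h(X,Y)YM-U\otimes YM\|_1<1-a(\epsilon).$$ -/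

import Mathlib

open scoped Matrix Kronecker ComplexOrder

noncomputable section

namespace QExtract

/-- Bit strings of length `n`. -/
abbrev Bits (n : ℕ) : Type := Fin n → Bool

/-! ### Classical notions -/

/-- The binary entropy function, with base-2 logarithms. -/
def binEntropy₂ (p : ℝ) : ℝ :=
  -p * Real.logb 2 p - (1 - p) * Real.logb 2 (1 - p)

/-- The min-entropy `-log₂ (max_x p x)` of a distribution on a finite nonempty set. -/
def minEntropy {A : Type*} (p : A → ℝ) : ℝ :=
  -Real.logb 2 (⨆ a, p a)

/-- The distribution of `(h(X,Y), Y)` when `(X,Y)` has distribution `P`. -/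
def outputDist {A B : Type*} [Fintype A] (h : A × B → Bool) (P : A × B → ℝ) : Bool × B → ℝ :=
  fun z => ∑ x : A, if h (x, z.2) = z.1 then P (x, z.2) else 0

/-- `h` is a strong `(k, ε)`-extractor: for every distribution `p` of `X` with min-entropy at least
`k`, and `Y` uniform and independent of `X` (so that `(X,Y)` has distribution `p x * |B|⁻¹`),
the `ℓ₁` distance between `(h(X,Y), Y)` and `U ⊗ Y` is less than `2 ε`. -/
def IsStrongExtractor {A B : Type*} [Fintype A] [Fintype B]
    (k ε : ℝ) (h : A × B → Bool) : Prop :=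
  ∀ p : A → ℝ, p ∈ stdSimplex ℝ A → k ≤ minEntropy p →
    ∑ z : Bool × B,
      |outputDist h (fun xy => p xy.1 * (Fintype.card B : ℝ)⁻¹) z
        - (1 / 2) * (Fintype.card B : ℝ)⁻¹| < 2 * ε

/-! ### Finite-dimensional quantum systems

A system with index set `A` has Hilbert space `ℂ^A`, with the standard basis `|a⟩`, `a : A`;
a composite system has the product as its index set. -/

/-- A quantum state: positive semidefinite of trace one. -/
def IsState {A : Type*} [Fintype A] (ρ : Matrix A A ℂ) : Prop :=
  ρ.PosSemidef ∧ ρ.trace = 1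

/-- The trace norm `‖M‖₁ = Tr √(M† M)`. -/
def traceNorm {A : Type*} [Fintype A] [DecidableEq A] (M : Matrix A A ℂ) : ℝ :=
  (cfc Real.sqrt (Mᴴ * M)).trace.re

/-- The von Neumann entropy `S(ρ) = -Tr (ρ log₂ ρ)` (here `Real.logb 2 0 = 0`, so that
`0 log 0 = 0` as usual). -/
def entropy {A : Type*} [Fintype A] [DecidableEq A] (ρ : Matrix A A ℂ) : ℝ :=
  -(ρ * cfc (Real.logb 2) ρ).trace.re

/-- Partial trace over the first factor. -/
def traceFst {A B : Type*} [Fintype A] (ρ : Matrix (A × B) (A × B) ℂ) : Matrix B B ℂ :=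
  Matrix.of fun b b' => ∑ a : A, ρ (a, b) (a, b')

/-- Partial trace over the second factor. -/
def traceSnd {A B : Type*} [Fintype B] (ρ : Matrix (A × B) (A × B) ℂ) : Matrix A A ℂ :=
  Matrix.of fun a a' => ∑ b : B, ρ (a, b) (a', b)

/-- The mutual information `I(A : B) = S(A) + S(B) - S(AB)` of a bipartite state. -/
def mutualInfo {A B : Type*} [Fintype A] [Fintype B] [DecidableEq A] [DecidableEq B]
    (ρ : Matrix (A × B) (A × B) ℂ) : ℝ :=
  entropy (traceSnd ρ) + entropy (traceFst ρ) - entropy ρ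

/-- The uniform distribution, as a diagonal density matrix. -/
def uniformState (A : Type*) [Fintype A] [DecidableEq A] : Matrix A A ℂ :=
  Matrix.diagonal fun _ => (Fintype.card A : ℂ)⁻¹

/-- In the state `ρ` of a system `YXM`, the part `YX` is classical: `ρ` has the form
`∑ |y,x⟩⟨y,x| ⊗ σ_{y,x}`, that is, it is block diagonal. -/
def IsClassicalYX {Y X D : Type*} (ρ : Matrix (Y × X × D) (Y × X × D) ℂ) : Prop :=
  ∀ y x d y' x' d', (y, x) ≠ (y', x') → ρ (y, x, d) (y', x', d') = 0

/-- The state of `YM`, for a system `YXM` in state `ρ` (the partial trace over `X`). -/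
def stateYM {Y X D : Type*} [Fintype X] (ρ : Matrix (Y × X × D) (Y × X × D) ℂ) :
    Matrix (Y × D) (Y × D) ℂ :=
  Matrix.of fun i j => ∑ x : X, ρ (i.1, x, i.2) (j.1, x, j.2)

/-- The state of `h(X,Y) Y M`, for a system `YXM` in state `ρ`: the value of `h` is written in a
new register, `|y,x,d⟩ ↦ |h(x,y)⟩|y,x,d⟩`, and `X` is then traced out. If `YX` is classical, so that
`ρ = ∑ |y,x⟩⟨y,x| ⊗ σ_{y,x}`, this is `∑ |h(x,y)⟩⟨h(x,y)| ⊗ |y⟩⟨y| ⊗ σ_{y,x}`. -/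
def outputState {Y X D : Type*} [Fintype X] (h : X × Y → Bool)
    (ρ : Matrix (Y × X × D) (Y × X × D) ℂ) : Matrix (Bool × Y × D) (Bool × Y × D) ℂ :=
  Matrix.of fun i j => ∑ x : X,
    if h (x, i.2.1) = i.1 ∧ h (x, j.2.1) = j.1 then ρ (i.2.1, x, i.2.2) (j.2.1, x, j.2.2) else 0

/-! ### The constants -/

/-- `a(ε) = (1/4) (1/2 - ε)³`. -/
def aConst (ε : ℝ) : ℝ := (1 / 4) * (1 / 2 - ε) ^ 3

/-- `b(ε) = ε (S(1/4 - ε/2) - S(1/8 - ε/4))`. -/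
def bConst (ε : ℝ) : ℝ :=
  ε * (binEntropy₂ (1 / 4 - ε / 2) - binEntropy₂ (1 / 8 - ε / 4))

end QExtract

end

/-! Write `g = 1/2 - ε` and argue by contraposition. By Helstrom's formula, a trace distance of at
least `1 - a(ε)` yields for each seed `y` a projective measurement of `M` guessing `h(X,y)`, with
error at most `a(ε)/2 = g³/8` on average over `y` (`exists_traceNorm_outputState_eq`). Such guesses
force `M` to carry much information about `X`.

For a set `S` of strings, let `G(S)` be `|S|` times the Holevo information, in nats, of the ensemble
restricted to uniform `x ∈ S`. Splitting `S` by the bit `h(·,y)` and using the chain rule, `G(S)`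
exceeds the sum of `G` over the two halves by `|S|` times the entropy of the bit, up to a Fano-type
loss `2√(|S|·error)` (`vonNeumann_add_sub_le`). If `|S| ≥ 2^k` and the error on `S` is small on
average over seeds, the extractor property supplies a seed whose bit is both reasonably balanced and
well guessed (`IsStrongExtractor.exists_seed`); the loss then consumes at most 4/5 of the bit's
entropy.

Repeating this along a decision tree of adaptively chosen seeds (`IsStrongExtractor.le_of_split`)
gains one fifth of `|S| (log |S| - k log 2)`. Sets with large error are abandoned; they are charged,
as in Markov's inequality, to a penalty linear in the error, hence additive under splitting. At the
root the penalty takes at most 13/20 of the gain, which leaves `I(X:M) ≥ (7/100)(n - k)`. Since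
`b(ε) ≤ 7/100` (`bConst_le`), this contradicts the hypothesis on `I(X:M)`. -/

namespace QExtract

/-! ### Functional calculus and traces of Hermitian matrices -/

section FunctionalCalculus

variable {m n : Type*} [Fintype m] [DecidableEq m] [Fintype n] [DecidableEq n]

lemma continuousOn_spectrum (f : ℝ → ℝ) (A : Matrix n n ℂ) : ContinuousOn f (spectrum ℝ A) :=
  A.finite_real_spectrum.continuousOn f

lemma cfc_mul_cfc {A : Matrix n n ℂ} (f g : ℝ → ℝ) :
    cfc f A * cfc g A = cfc (fun x => f x * g x) A :=
  (cfc_mul f g A (continuousOn_spectrum f A) (continuousOn_spectrum g A)).symm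

lemma isHermitian_cfc (f : ℝ → ℝ) (A : Matrix n n ℂ) : (cfc f A).IsHermitian :=
  cfc_predicate f A

/-- On two Hermitian matrices the functional calculus is given by one common polynomial. -/
lemma exists_polynomial_cfc {A : Matrix m m ℂ} {B : Matrix n n ℂ} (hA : A.IsHermitian)
    (hB : B.IsHermitian) (f : ℝ → ℝ) :
    ∃ p : Polynomial ℝ, cfc f A = Polynomial.aeval A p ∧ cfc f B = Polynomial.aeval B p := by
  classical
  set s : Finset ℝ := (A.finite_real_spectrum.union B.finite_real_spectrum).toFinset with hs
  have heval : ∀ x ∈ s, (Lagrange.interpolate s id f).eval x = f x := fun x hx =>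
    Lagrange.eval_interpolate_at_node (v := id) f (Set.injOn_id _) hx
  refine ⟨Lagrange.interpolate s id f, ?_, ?_⟩
  · rw [← cfc_polynomial _ A hA.isSelfAdjoint]
    exact cfc_congr fun x hx => (heval x (by simp [hs, hx])).symm
  · rw [← cfc_polynomial _ B hB.isSelfAdjoint]
    exact cfc_congr fun x hx => (heval x (by simp [hs, hx])).symm

/-- The functional calculus respects intertwiners. -/
lemma cfc_mul_of_mul_eq {A : Matrix m m ℂ} {B : Matrix n n ℂ} (hA : A.IsHermitian)
    (hB : B.IsHermitian) {V : Matrix m n ℂ} (h : A * V = V * B) (f : ℝ → ℝ) :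
    cfc f A * V = V * cfc f B := by
  obtain ⟨p, hpA, hpB⟩ := exists_polynomial_cfc hA hB f
  have hpow : ∀ k : ℕ, A ^ k * V = V * B ^ k := by
    intro k
    induction k with
    | zero => simp
    | succ k ih => rw [pow_succ, Matrix.mul_assoc, h, ← Matrix.mul_assoc, ih, Matrix.mul_assoc,
        ← pow_succ]
  rw [hpA, hpB, Polynomial.aeval_eq_sum_range, Polynomial.aeval_eq_sum_range, Matrix.sum_mul,
    Matrix.mul_sum]
  exact Finset.sum_congr rfl fun k _ => by rw [Matrix.smul_mul, Matrix.mul_smul, hpow]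

/-- The trace of a function of a block diagonal Hermitian matrix. -/
lemma trace_cfc_blocks {o ι : Type*} [Fintype o] [Fintype ι] [DecidableEq ι]
    [DecidableEq o] (e : o × n ≃ ι) {M : Matrix ι ι ℂ} {N : o → Matrix n n ℂ}
    (hN : ∀ i, (N i).IsHermitian)
    (hM : ∀ i d j d', M (e (i, d)) (e (j, d')) = if i = j then N i d d' else 0) (f : ℝ → ℝ) :
    (cfc f M).trace = ∑ i, (cfc f (N i)).trace := by
  have hMH : M.IsHermitian := by
    ext a b
    obtain ⟨⟨i, d⟩, rfl⟩ := e.surjective a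
    obtain ⟨⟨j, d'⟩, rfl⟩ := e.surjective b
    rw [Matrix.conjTranspose_apply, hM, hM]
    by_cases hij : i = j
    · subst hij
      simpa using (hN i).apply d d'
    · simp [hij, Ne.symm hij]
  have key : ∀ i d, cfc f M (e (i, d)) (e (i, d)) = cfc f (N i) d d := by
    intro i d
    -- The isometry embedding block `i`; it intertwines `N i` with `M`, hence also their functional
    -- calculi.
    set V : Matrix ι n ℂ := (1 : Matrix ι ι ℂ).submatrix id (fun d => e (i, d)) with hV
    have hmul : M * V = V * N i := by
      ext a c
      obtain ⟨⟨j, d'⟩, rfl⟩ := e.surjective a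
      simp only [hV, Matrix.mul_apply, Matrix.submatrix_apply, Matrix.one_apply, id, mul_ite,
        mul_one, mul_zero, ite_mul, one_mul, zero_mul, EmbeddingLike.apply_eq_iff_eq,
        Finset.sum_ite_eq', Finset.mem_univ, if_true, hM, Prod.mk.injEq]
      by_cases hij : j = i
      · subst hij; simp
      · simp [hij]
    have := congrFun (congrFun (cfc_mul_of_mul_eq hMH (hN i) hmul f) (e (i, d))) d
    simpa [hV, Matrix.mul_apply, Matrix.one_apply] using this
  rw [Matrix.trace, ← e.sum_comp, Fintype.sum_prod_type]
  exact Finset.sum_congr rfl fun i _ => Finset.sum_congr rfl fun d _ => key i d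

/-- Traces of products of functions of two Hermitian matrices, by simultaneous eigenbasis
expansion. -/
lemma exists_weights {A B : Matrix n n ℂ} (hA : A.IsHermitian) (hB : B.IsHermitian) :
    ∃ w : n → n → ℝ, (∀ i j, 0 ≤ w i j) ∧ ∀ f g : ℝ → ℝ,
      (cfc f A * cfc g B).trace.re
        = ∑ i, ∑ j, w i j * (f (hA.eigenvalues i) * g (hB.eigenvalues j)) := by
  set U : Matrix n n ℂ := (hA.eigenvectorUnitary : Matrix n n ℂ) with hU
  set V : Matrix n n ℂ := (hB.eigenvectorUnitary : Matrix n n ℂ) with hV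
  -- The weights are the squared overlaps of the two eigenbases, so trace inequalities reduce to
  -- scalar ones.
  refine ⟨fun i j => Complex.normSq ((Uᴴ * V) i j), fun i j => Complex.normSq_nonneg _, ?_⟩
  intro f g
  rw [hA.cfc_eq, hB.cfc_eq, Matrix.IsHermitian.cfc, Matrix.IsHermitian.cfc,
    Unitary.conjStarAlgAut_apply, Unitary.conjStarAlgAut_apply]
  change (U * _ * Uᴴ * (V * _ * Vᴴ)).trace.re = _
  set F : Matrix n n ℂ := Matrix.diagonal (RCLike.ofReal ∘ f ∘ hA.eigenvalues) with hF
  set G : Matrix n n ℂ := Matrix.diagonal (RCLike.ofReal ∘ g ∘ hB.eigenvalues) with hG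
  have : (U * F * Uᴴ * (V * G * Vᴴ)).trace = (F * (Uᴴ * V) * (G * (Uᴴ * V)ᴴ)).trace := by
    rw [Matrix.conjTranspose_mul, Matrix.conjTranspose_conjTranspose]
    have : U * F * Uᴴ * (V * G * Vᴴ) = U * (F * (Uᴴ * V) * (G * Vᴴ)) := by
      simp only [Matrix.mul_assoc]
    rw [this, Matrix.trace_mul_comm]
    simp only [Matrix.mul_assoc]
  rw [this, Matrix.trace]
  simp only [Matrix.diag_apply, Matrix.mul_apply (M := F * (Uᴴ * V)), Complex.re_sum]
  refine Finset.sum_congr rfl fun i _ => Finset.sum_congr rfl fun j _ => ?_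
  rw [hF, hG, Matrix.diagonal_mul, Matrix.diagonal_mul, Matrix.conjTranspose_apply]
  simp only [Function.comp_apply, Complex.normSq_apply, Complex.mul_re, Complex.mul_im,
    Complex.star_def, Complex.conj_re, Complex.conj_im, RCLike.ofReal_eq_complex_ofReal,
    Complex.ofReal_re, Complex.ofReal_im]
  ring

lemma trace_mul_nonneg {A B : Matrix n n ℂ} (hA : A.PosSemidef) (hB : B.PosSemidef) :
    0 ≤ (A * B).trace.re := by
  obtain ⟨w, hw, h⟩ := exists_weights hA.isHermitian hB.isHermitian
  have := h id id
  rw [cfc_id ℝ A hA.isHermitian.isSelfAdjoint, cfc_id ℝ B hB.isHermitian.isSelfAdjoint] at this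
  rw [this]
  exact Finset.sum_nonneg fun i _ => Finset.sum_nonneg fun j _ =>
    mul_nonneg (hw i j) (mul_nonneg (hA.eigenvalues_nonneg i) (hB.eigenvalues_nonneg j))

lemma posSemidef_cfc {f : ℝ → ℝ} (hf : ∀ x, 0 ≤ f x) (A : Matrix n n ℂ) :
    (cfc f A).PosSemidef := by
  have : cfc f A = (cfc (fun x => √(f x)) A)ᴴ * cfc (fun x => √(f x)) A := by
    rw [(isHermitian_cfc _ A).eq, cfc_mul_cfc]
    exact congrArg (cfc · A) (funext fun x => (Real.mul_self_sqrt (hf x)).symm)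
  rw [this]
  exact Matrix.posSemidef_conjTranspose_mul_self _

/-- Trace norms of Hermitian matrices are attained on a projection. -/
lemma exists_projection_traceNorm {T : Matrix n n ℂ} (hT : T.IsHermitian) :
    ∃ E : Matrix n n ℂ, E.IsHermitian ∧ E * E = E ∧
      traceNorm T = (E * T).trace.re - ((1 - E) * T).trace.re := by
  -- The projection onto the nonnegative spectral part of `T`.
  set s : ℝ → ℝ := fun x => if 0 ≤ x then 1 else 0 with hs
  refine ⟨cfc s T, isHermitian_cfc _ _, ?_, ?_⟩
  · rw [cfc_mul_cfc]
    refine congrArg (cfc · T) (funext fun x => ?_)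
    simp only [hs]; split_ifs <;> simp
  · have hsq : Tᴴ * T = cfc (fun x : ℝ => x * x) T := by
      rw [hT.eq]
      conv_lhs => rw [← cfc_id ℝ T hT.isSelfAdjoint]
      exact cfc_mul_cfc _ _
    have h1 : cfc Real.sqrt (Tᴴ * T) = cfc (fun x : ℝ => |x|) T := by
      rw [hsq, ← cfc_comp' Real.sqrt (fun x : ℝ => x * x) T
        ((T.finite_real_spectrum.image _).continuousOn _)
        (continuousOn_spectrum _ _) hT.isSelfAdjoint]
      exact congrArg (cfc · T) (funext fun x => Real.sqrt_mul_self_eq_abs x)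
    have h2 : cfc (fun x : ℝ => |x|) T = cfc s T * T - (1 - cfc s T) * T := by
      have h3 : cfc s T * T = cfc (fun x => s x * x) T := by
        rw [← cfc_mul_cfc s fun x => x, cfc_id' ℝ T hT.isSelfAdjoint]
      have h4 : (1 - cfc s T) * T = cfc (fun x => s x * x) T - cfc (fun x : ℝ => |x|) T := by
        rw [Matrix.sub_mul, one_mul, h3, sub_eq_iff_eq_add]
        refine (cfc_id' ℝ T hT.isSelfAdjoint).symm.trans ?_
        rw [← cfc_sub (fun x => s x * x) (fun x : ℝ => |x|) T (continuousOn_spectrum _ _)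
            (continuousOn_spectrum _ _),
          ← cfc_add (a := T) (fun x => s x * x - |x|) (fun x => s x * x)
            (continuousOn_spectrum _ _) (continuousOn_spectrum _ _)]
        refine congrArg (cfc · T) (funext fun x => ?_)
        simp only [hs]
        split_ifs with h
        · rw [abs_of_nonneg h]; ring
        · rw [abs_of_neg (not_le.mp h)]; ring
      rw [h3, h4]
      abel
    rw [traceNorm, h1, h2, Matrix.trace_sub, Complex.sub_re]

end FunctionalCalculus

/-! ### Von Neumann entropy, relative entropy and a Fano-type inequality -/

section Entropy

variable {n : Type*} [Fintype n] [DecidableEq n]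

/-- The function `-Tr (A log A)` with natural logarithms, for matrices of any trace. -/
noncomputable def vonNeumann (A : Matrix n n ℂ) : ℝ := (cfc Real.negMulLog A).trace.re

lemma cfc_id_mul {A : Matrix n n ℂ} (hA : A.IsHermitian) (f : ℝ → ℝ) :
    A * cfc f A = cfc (fun x => x * f x) A := by
  rw [← cfc_mul_cfc (fun x => x) f, cfc_id' ℝ A hA.isSelfAdjoint]

lemma vonNeumann_eq {A : Matrix n n ℂ} (hA : A.IsHermitian) :
    vonNeumann A = -(A * cfc Real.log A).trace.re := by
  rw [vonNeumann, cfc_id_mul hA, ← Complex.neg_re, ← Matrix.trace_neg,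
    ← cfc_neg (a := A) (fun x => x * Real.log x)]
  congr 3
  funext x
  simp [Real.negMulLog]

lemma entropy_eq_vonNeumann_div {A : Matrix n n ℂ} (hA : A.IsHermitian) :
    entropy A = vonNeumann A / Real.log 2 := by
  have h : cfc (Real.logb 2) A = (Real.log 2)⁻¹ • cfc Real.log A := by
    rw [← cfc_smul (a := A) (Real.log 2)⁻¹ Real.log (continuousOn_spectrum _ _)]
    congr 1
    funext x
    simp [Real.logb, div_eq_inv_mul]
  rw [vonNeumann_eq hA, entropy, h, Matrix.mul_smul, Matrix.trace_smul, Complex.smul_re,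
    smul_eq_mul]
  ring

/-- Simultaneous expansion when `A ≤ R`: the weights vanish off the support of `R`. -/
lemma exists_weights_of_le {A R : Matrix n n ℂ} (hA : A.PosSemidef) (hR : R.PosSemidef)
    (hAR : (R - A).PosSemidef) :
    ∃ w : n → n → ℝ, (∀ i j, 0 ≤ w i j) ∧
      (∀ i j, hR.isHermitian.eigenvalues j = 0 → w i j * hA.isHermitian.eigenvalues i = 0) ∧
      ∀ f g : ℝ → ℝ, (cfc f A * cfc g R).trace.re
        = ∑ i, ∑ j, w i j *
          (f (hA.isHermitian.eigenvalues i) * g (hR.isHermitian.eigenvalues j)) := by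
  obtain ⟨w, hw, h⟩ := exists_weights hA.isHermitian hR.isHermitian
  refine ⟨w, hw, ?_, h⟩
  -- Testing `R - A ≥ 0` against the kernel projection of `R` shows that `A` has no weight there.
  -- This matters because of the convention `log 0 = 0`.
  set g : ℝ → ℝ := fun x => if x = 0 then 1 else 0 with hg
  have hg0 : ∀ x, 0 ≤ g x := fun x => by simp only [hg]; split_ifs <;> norm_num
  have h1 := trace_mul_nonneg hAR (posSemidef_cfc hg0 R)
  have h2 : R * cfc g R = 0 := by
    rw [cfc_id_mul hR.isHermitian]
    have : (fun x => x * g x) = fun _ => 0 := by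
      funext x; by_cases hx : x = 0 <;> simp [hg, hx]
    rw [this, cfc_const_zero]
  rw [Matrix.sub_mul, h2, zero_sub, Matrix.trace_neg, Complex.neg_re] at h1
  have h3 := h (fun x => x) g
  rw [cfc_id' ℝ A hA.isHermitian.isSelfAdjoint] at h3
  have hnn : ∀ i j, 0 ≤ w i j *
      (hA.isHermitian.eigenvalues i * g (hR.isHermitian.eigenvalues j)) := fun i j =>
    mul_nonneg (hw i j) (mul_nonneg (hA.eigenvalues_nonneg i) (hg0 _))
  intro i j hj
  have h4 : ∑ i, ∑ j, w i j *
      (hA.isHermitian.eigenvalues i * g (hR.isHermitian.eigenvalues j)) = 0 :=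
    le_antisymm (by linarith) (Finset.sum_nonneg fun i _ => Finset.sum_nonneg fun j _ => hnn i j)
  rw [Finset.sum_eq_zero_iff_of_nonneg fun i _ => Finset.sum_nonneg fun j _ => hnn i j] at h4
  have h5 := h4 i (Finset.mem_univ i)
  rw [Finset.sum_eq_zero_iff_of_nonneg fun j _ => hnn i j] at h5
  simpa [hg, hj] using h5 j (Finset.mem_univ j)

/-- A lower bound on the relative entropy by the overlap of square roots. -/
lemma trace_log_sub_log_le {A R : Matrix n n ℂ} (hA : A.PosSemidef) (hR : R.PosSemidef)
    (hAR : (R - A).PosSemidef) :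
    (A * cfc Real.log R).trace.re + vonNeumann A
      ≤ 2 * ((cfc Real.sqrt A * cfc Real.sqrt R).trace.re - A.trace.re) := by
  obtain ⟨w, hw, h0, h⟩ := exists_weights_of_le hA hR hAR
  have h1 := h (fun x => x) Real.log
  have h2 := h Real.negMulLog (fun _ => 1)
  have h3 := h (fun x => x) (fun _ => 1)
  have h4 := h Real.sqrt Real.sqrt
  rw [cfc_const_one ℝ R hR.isHermitian.isSelfAdjoint, mul_one] at h2 h3
  rw [cfc_id' ℝ A hA.isHermitian.isSelfAdjoint] at h1 h3
  rw [h1, vonNeumann, h2, h3, h4]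
  simp only [← Finset.sum_sub_distrib, Finset.mul_sum, ← Finset.sum_add_distrib]
  refine Finset.sum_le_sum fun i _ => Finset.sum_le_sum fun j _ => ?_
  have ha := hA.eigenvalues_nonneg i
  have hr := hR.eigenvalues_nonneg j
  have hz := h0 i j
  have hwij := hw i j
  generalize hA.isHermitian.eigenvalues i = a at *
  generalize hR.isHermitian.eigenvalues j = r at *
  rcases ha.eq_or_lt with rfl | ha'
  · simp
  rcases hr.eq_or_lt with rfl | hr'
  · have : w i j = 0 := by simpa [ha'.ne'] using hz rfl
    simp [this]
  have hsa := Real.sqrt_pos.mpr ha'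
  have hsr := Real.sqrt_pos.mpr hr'
  -- Using `log t ≤ t - 1` at the square root of `r / a`, rather than at `r / a`, produces the
  -- overlap of square roots and the factor 2.
  have hlog := Real.log_le_sub_one_of_pos (div_pos hsr hsa)
  rw [Real.log_div hsr.ne' hsa.ne', Real.log_sqrt hr, Real.log_sqrt ha] at hlog
  have e : a * (√r / √a - 1) = √a * √r - a := by
    have hq : a / √a = √a := Real.div_sqrt
    rw [mul_sub, mul_one, mul_div_assoc', mul_comm a, mul_div_assoc, hq, mul_comm]
  have h5 := mul_le_mul_of_nonneg_left hlog ha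
  rw [e] at h5
  have h6 : a * Real.log r + Real.negMulLog a ≤ 2 * (√a * √r - a) := by
    rw [Real.negMulLog]; linarith
  have h7 := mul_le_mul_of_nonneg_left h6 hwij
  linarith

/-- Klein's inequality for `A` and `R / s`; the free scale `s` makes it sharp for ensembles of `s`
equally weighted members. -/
lemma trace_log_sub_log_le_scaled {A R : Matrix n n ℂ} (hA : A.PosSemidef) (hR : R.PosSemidef)
    (hAR : (R - A).PosSemidef) {s : ℝ} (hs : 0 < s) :
    (A * cfc Real.log R).trace.re + vonNeumann A
      ≤ R.trace.re / s - A.trace.re + A.trace.re * Real.log s := by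
  obtain ⟨w, hw, h0, h⟩ := exists_weights_of_le hA hR hAR
  have h1 := h (fun x => x) Real.log
  have h2 := h Real.negMulLog (fun _ => 1)
  have h3 := h (fun x => x) (fun _ => 1)
  have h4 := h (fun _ => 1) (fun x => x)
  rw [cfc_const_one ℝ R hR.isHermitian.isSelfAdjoint, mul_one] at h2 h3
  rw [cfc_const_one ℝ A hA.isHermitian.isSelfAdjoint, one_mul] at h4
  rw [cfc_id' ℝ A hA.isHermitian.isSelfAdjoint] at h1 h3
  rw [cfc_id' ℝ R hR.isHermitian.isSelfAdjoint] at h4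
  rw [h1, vonNeumann, h2, h3, h4]
  simp only [← Finset.sum_sub_distrib, Finset.sum_mul, Finset.sum_div, ← Finset.sum_add_distrib]
  refine Finset.sum_le_sum fun i _ => Finset.sum_le_sum fun j _ => ?_
  have ha := hA.eigenvalues_nonneg i
  have hr := hR.eigenvalues_nonneg j
  have hz := h0 i j
  have hwij := hw i j
  generalize hA.isHermitian.eigenvalues i = a at *
  generalize hR.isHermitian.eigenvalues j = r at *
  rcases ha.eq_or_lt with rfl | ha'
  · simpa using by positivity
  rcases hr.eq_or_lt with rfl | hr'
  · have : w i j = 0 := by simpa [ha'.ne'] using hz rfl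
    simp [this]
  have hlog := Real.log_le_sub_one_of_pos (show 0 < r / (s * a) by positivity)
  rw [Real.log_div hr'.ne' (by positivity), Real.log_mul hs.ne' ha'.ne'] at hlog
  have e : a * (r / (s * a) - 1) = r / s - a := by
    field_simp
  have h5 := mul_le_mul_of_nonneg_left hlog ha
  rw [e] at h5
  have h6 : a * Real.log r + Real.negMulLog a ≤ r / s - a + a * Real.log s := by
    rw [Real.negMulLog]; linarith
  have h7 := mul_le_mul_of_nonneg_left h6 hwij
  rw [mul_add, mul_add, mul_sub] at h7
  simp only [mul_one, one_mul, mul_assoc, mul_div_assoc]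
  linarith

omit [DecidableEq n] in
lemma trace_conjTranspose_mul_re_le (X Y : Matrix n n ℂ) :
    (Xᴴ * Y).trace.re ≤ √((Xᴴ * X).trace.re) * √((Yᴴ * Y).trace.re) := by
  have hsq : ∀ Z : Matrix n n ℂ, (Zᴴ * Z).trace.re = ∑ p : n × n, ‖Z p.2 p.1‖ ^ 2 := by
    intro Z
    rw [Fintype.sum_prod_type, Matrix.trace, Complex.re_sum]
    refine Finset.sum_congr rfl fun i _ => ?_
    rw [Matrix.diag_apply, Matrix.mul_apply, Complex.re_sum]
    refine Finset.sum_congr rfl fun j _ => ?_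
    rw [Matrix.conjTranspose_apply, Complex.sq_norm, Complex.normSq_apply]
    simp
  rw [hsq, hsq]
  refine le_trans ?_ (Real.sum_mul_le_sqrt_mul_sqrt _ _ _)
  rw [Fintype.sum_prod_type, Matrix.trace, Complex.re_sum]
  refine Finset.sum_le_sum fun i _ => ?_
  rw [Matrix.diag_apply, Matrix.mul_apply, Complex.re_sum]
  refine Finset.sum_le_sum fun j _ => ?_
  refine (Complex.re_le_norm _).trans ?_
  rw [norm_mul, Matrix.conjTranspose_apply, norm_star]

/-- The overlap of square roots can only grow under a two-outcome measurement. -/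
lemma trace_sqrt_mul_sqrt_le {A R E : Matrix n n ℂ} (hA : A.PosSemidef) (hR : R.PosSemidef)
    (hE : E.IsHermitian) (hEE : E * E = E) :
    (cfc Real.sqrt A * cfc Real.sqrt R).trace.re
      ≤ √((E * A).trace.re) * √((E * R).trace.re)
        + √(((1 - E) * A).trace.re) * √(((1 - E) * R).trace.re) := by
  have hsqrt : ∀ {B : Matrix n n ℂ}, B.PosSemidef → cfc Real.sqrt B * cfc Real.sqrt B = B := by
    intro B hB
    rw [cfc_mul_cfc]
    conv_rhs => rw [← cfc_id' ℝ B hB.isHermitian.isSelfAdjoint]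
    refine cfc_congr fun x hx => ?_
    rw [hB.isHermitian.spectrum_real_eq_range_eigenvalues] at hx
    obtain ⟨i, rfl⟩ := hx
    exact Real.mul_self_sqrt (hB.eigenvalues_nonneg i)
  have main : ∀ F : Matrix n n ℂ, F.IsHermitian → F * F = F →
      (cfc Real.sqrt A * (F * cfc Real.sqrt R)).trace.re
        ≤ √((F * A).trace.re) * √((F * R).trace.re) := by
    intro F hF hFF
    -- Cauchy–Schwarz for the Hilbert–Schmidt inner product, separately for each outcome.
    have hc := trace_conjTranspose_mul_re_le (F * cfc Real.sqrt A) (F * cfc Real.sqrt R)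
    have hgen : ∀ B C : Matrix n n ℂ, (F * cfc Real.sqrt B)ᴴ * (F * cfc Real.sqrt C)
        = cfc Real.sqrt B * (F * cfc Real.sqrt C) := by
      intro B C
      rw [Matrix.conjTranspose_mul, (isHermitian_cfc _ B).eq, hF.eq, Matrix.mul_assoc,
        ← Matrix.mul_assoc F F, hFF]
    have hself : ∀ {B : Matrix n n ℂ}, B.PosSemidef →
        (cfc Real.sqrt B * (F * cfc Real.sqrt B)).trace = (F * B).trace := by
      intro B hB
      rw [Matrix.trace_mul_comm, Matrix.mul_assoc, hsqrt hB]
    rwa [hgen, hgen, hgen, hself hA, hself hR] at hc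
  have hE' : (1 - E).IsHermitian := Matrix.isHermitian_one.sub hE
  have hEE' : (1 - E) * (1 - E) = 1 - E := by
    rw [Matrix.sub_mul, Matrix.mul_sub, Matrix.mul_sub, hEE]; simp
  have hsplit : cfc Real.sqrt A * cfc Real.sqrt R
      = cfc Real.sqrt A * (E * cfc Real.sqrt R) + cfc Real.sqrt A * ((1 - E) * cfc Real.sqrt R) := by
    rw [← Matrix.mul_add, ← Matrix.add_mul]; simp
  rw [hsplit, Matrix.trace_add, Complex.add_re]
  exact add_le_add (main E hE hEE) (main _ hE' hEE')

omit [DecidableEq n] in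
lemma posSemidef_of_projection {E : Matrix n n ℂ} (hE : E.IsHermitian) (hEE : E * E = E) :
    E.PosSemidef := by
  have := Matrix.posSemidef_conjTranspose_mul_self E
  rwa [hE.eq, hEE] at this

lemma posSemidef_one_sub_of_projection {E : Matrix n n ℂ} (hE : E.IsHermitian)
    (hEE : E * E = E) : (1 - E).PosSemidef := by
  refine posSemidef_of_projection (Matrix.isHermitian_one.sub hE) ?_
  rw [Matrix.sub_mul, Matrix.mul_sub, Matrix.mul_sub, hEE]; simp

/-- A Fano-type inequality: the entropy of a bit given a quantum system is small if a projective
measurement of the system guesses the bit with small error. -/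
lemma vonNeumann_add_sub_le {A B E : Matrix n n ℂ} (hA : A.PosSemidef) (hB : B.PosSemidef)
    (hE : E.IsHermitian) (hEE : E * E = E) :
    vonNeumann A + vonNeumann B - vonNeumann (A + B)
      ≤ 2 * √((A + B).trace.re * (((1 - E) * A).trace.re + (E * B).trace.re)) := by
  have hR := hA.add hB
  have hEp := posSemidef_of_projection hE hEE
  have hFp := posSemidef_one_sub_of_projection hE hEE
  have h1 := trace_log_sub_log_le hA hR (by simpa using hB)
  have h2 := trace_log_sub_log_le hB hR (by simpa using hA)
  have h3 := trace_sqrt_mul_sqrt_le hA hR hE hEE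
  have h4 := trace_sqrt_mul_sqrt_le hB hR hE hEE
  have h5 : vonNeumann (A + B)
      = -((A * cfc Real.log (A + B)).trace.re + (B * cfc Real.log (A + B)).trace.re) := by
    rw [vonNeumann_eq hR.isHermitian, Matrix.add_mul, Matrix.trace_add, Complex.add_re]
  have htr : ∀ C : Matrix n n ℂ, C.trace.re = (E * C).trace.re + ((1 - E) * C).trace.re := by
    intro C
    rw [← Complex.add_re, ← Matrix.trace_add, ← Matrix.add_mul]; simp
  have hadd : ∀ F : Matrix n n ℂ, (F * (A + B)).trace.re = (F * A).trace.re + (F * B).trace.re := by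
    intro F
    rw [Matrix.mul_add, Matrix.trace_add, Complex.add_re]
  rw [htr (A + B), hadd E, hadd (1 - E)]
  rw [hadd E, hadd (1 - E)] at h3 h4
  rw [htr A] at h1
  rw [htr B] at h2
  have p1 := trace_mul_nonneg hEp hA
  have p2 := trace_mul_nonneg hFp hA
  have p3 := trace_mul_nonneg hEp hB
  have p4 := trace_mul_nonneg hFp hB
  generalize (E * A).trace.re = a0 at *
  generalize ((1 - E) * A).trace.re = a1 at *
  generalize (E * B).trace.re = b0 at *
  generalize ((1 - E) * B).trace.re = b1 at *
  -- The terms of correct guesses, `a0` and `b1`, are bounded by the outcome probabilities and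
  -- cancel the total trace; those of wrong guesses, `b0` and `a1`, are handled in `q3` by
  -- Cauchy–Schwarz.
  have q1 : √a0 * √(a0 + b0) ≤ a0 + b0 := by
    calc √a0 * √(a0 + b0) ≤ √(a0 + b0) * √(a0 + b0) := by gcongr; linarith
      _ = a0 + b0 := Real.mul_self_sqrt (by linarith)
  have q2 : √b1 * √(a1 + b1) ≤ a1 + b1 := by
    calc √b1 * √(a1 + b1) ≤ √(a1 + b1) * √(a1 + b1) := by gcongr; linarith
      _ = a1 + b1 := Real.mul_self_sqrt (by linarith)
  have q3 : √b0 * √(a0 + b0) + √a1 * √(a1 + b1) ≤ √((a0 + b0 + (a1 + b1)) * (a1 + b0)) := by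
    apply Real.le_sqrt_of_sq_le
    have s1 := Real.sq_sqrt p3
    have s2 := Real.sq_sqrt p2
    have s3 := Real.sq_sqrt (add_nonneg p1 p3)
    have s4 := Real.sq_sqrt (add_nonneg p2 p4)
    have : (a0 + b0 + (a1 + b1)) * (a1 + b0)
        = (√(a0 + b0) ^ 2 + √(a1 + b1) ^ 2) * (√a1 ^ 2 + √b0 ^ 2) := by rw [s1, s2, s3, s4]
    rw [this]
    nlinarith [sq_nonneg (√b0 * √(a1 + b1) - √a1 * √(a0 + b0))]
  linarith

/-- Concavity of the entropy. -/
lemma sum_vonNeumann_le {ι : Type*} {σ : ι → Matrix n n ℂ} (hσ : ∀ x, (σ x).PosSemidef)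
    (S : Finset ι) :
    ∑ x ∈ S, vonNeumann (σ x)
      ≤ vonNeumann (∑ x ∈ S, σ x) + (∑ x ∈ S, σ x).trace.re * Real.log S.card := by
  classical
  rcases S.eq_empty_or_nonempty with rfl | hS
  · simp [vonNeumann, Real.negMulLog]
  have hc : (0 : ℝ) < S.card := by exact_mod_cast hS.card_pos
  have hR : (∑ x ∈ S, σ x).PosSemidef := Matrix.posSemidef_sum S fun x _ => hσ x
  set R := ∑ x ∈ S, σ x with hRdef
  have h : ∀ x ∈ S, (σ x * cfc Real.log R).trace.re + vonNeumann (σ x)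
      ≤ R.trace.re / S.card - (σ x).trace.re + (σ x).trace.re * Real.log S.card := by
    intro x hx
    refine trace_log_sub_log_le_scaled (hσ x) hR ?_ hc
    rw [hRdef, ← Finset.add_sum_erase S σ hx, add_sub_cancel_left]
    exact Matrix.posSemidef_sum _ fun x _ => hσ x
  have h' := Finset.sum_le_sum h
  have e1 : ∑ x ∈ S, (σ x * cfc Real.log R).trace.re = -vonNeumann R := by
    rw [vonNeumann_eq hR.isHermitian, neg_neg, ← Complex.re_sum, ← Matrix.trace_sum,
      ← Matrix.sum_mul]
  have e2 : ∑ x ∈ S, (σ x).trace.re = R.trace.re := by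
    rw [← Complex.re_sum, ← Matrix.trace_sum]
  rw [Finset.sum_add_distrib, Finset.sum_add_distrib, Finset.sum_sub_distrib, e1, e2,
    ← Finset.sum_mul, e2, Finset.sum_const, nsmul_eq_mul] at h'
  have e3 : (S.card : ℝ) * (R.trace.re / S.card) = R.trace.re := by field_simp
  linarith

end Entropy

/-! ### Numerical estimates for the binary entropy -/

section Scalar

lemma add_sq_div_two_le_neg_log {p : ℝ} (h0 : 0 ≤ p) (h1 : p < 1) :
    p + p ^ 2 / 2 ≤ -Real.log (1 - p) := by
  have h := sum_le_hasSum (Finset.range 2) (fun i _ => by positivity)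
    (Real.hasSum_pow_div_log_of_abs_lt_one (abs_lt.mpr ⟨by linarith, h1⟩))
  norm_num [Finset.sum_range_succ] at h
  linarith

lemma binEntropy_eq_neg (p : ℝ) :
    Real.binEntropy p = -(p * Real.log p) - (1 - p) * Real.log (1 - p) := by
  rw [Real.binEntropy_eq_negMulLog_add_negMulLog_one_sub, Real.negMulLog, Real.negMulLog]
  ring

/-- For `p ≤ 1/4`, the term `-p log p` contributes at least `2 log 2 · p` and the other at least
`27/32 · p`, and `2 log 2 + 27/32 > 11/5`. -/
lemma mul_le_binEntropy {p : ℝ} (h0 : 0 < p) (h1 : p ≤ 1 / 4) :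
    11 / 5 * p ≤ Real.binEntropy p := by
  rw [binEntropy_eq_neg]
  have hl : Real.log p ≤ -(2 * Real.log 2) := by
    have := Real.log_le_log h0 h1
    rwa [one_div, Real.log_inv, show (4 : ℝ) = 2 ^ 2 by norm_num, Real.log_pow, Nat.cast_two]
      at this
  have h2 := add_sq_div_two_le_neg_log h0.le (by linarith)
  have h3 := mul_le_mul_of_nonneg_left h2 (show 0 ≤ 1 - p by linarith)
  have h4 := mul_le_mul_of_nonneg_left hl h0.le
  have h5 := mul_le_mul_of_nonneg_left Real.log_two_gt_d9.le h0.le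
  have h6 : 27 / 32 * p ≤ (1 - p) * (p + p ^ 2 / 2) := by
    have : 0 ≤ p * ((1 / 4 - p) * (p + 5 / 4)) :=
      mul_nonneg h0.le (mul_nonneg (by linarith) (by linarith))
    nlinarith
  linarith

lemma mul_le_binEntropy_of_le {g p : ℝ} (hg : 0 < g) (hg' : g < 1 / 2) (hp : g / 2 ≤ p)
    (hp' : p ≤ 1 / 2) : 11 / 10 * g ≤ Real.binEntropy p := by
  have h1 := mul_le_binEntropy (p := g / 2) (by linarith) (by linarith)
  have h2 := Real.binEntropy_strictMonoOn.monotoneOn (a := g / 2) (b := p)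
    ⟨by linarith, by norm_num; linarith⟩ ⟨by linarith, by norm_num; linarith⟩ hp
  linarith

lemma binEntropy₂_eq_div (p : ℝ) : binEntropy₂ p = Real.binEntropy p / Real.log 2 := by
  rw [binEntropy₂, binEntropy_eq_neg, Real.logb, Real.logb]
  ring

lemma binEntropy_two_mul_sub_le {x : ℝ} (h0 : 0 < x) (h1 : x < 1 / 8) :
    Real.binEntropy (2 * x) - Real.binEntropy x ≤ 1 / 20 + 2 * x := by
  rw [binEntropy_eq_neg, binEntropy_eq_neg, Real.log_mul (by norm_num) h0.ne']
  have a1 : Real.log (1 - x) ≤ -x := by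
    have := Real.log_le_sub_one_of_pos (show 0 < 1 - x by linarith)
    linarith
  have a2 : -Real.log (1 - 2 * x) ≤ 2 * x / (1 - 2 * x) := by
    have h := Real.one_sub_inv_le_log_of_pos (show 0 < 1 - 2 * x by linarith)
    have : 2 * x / (1 - 2 * x) = (1 - 2 * x)⁻¹ - 1 := by
      field_simp [show 1 - 2 * x ≠ 0 by linarith]
      ring
    linarith
  -- From `log t ≤ t - 1` at `t = e⁻³ / x`: the point `e⁻³ ≈ 1/20` is close to the worst `x` in
  -- `bConst_le`.
  have a3 : -Real.log x ≤ 1 / 20 / x + 2 := by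
    have h := Real.log_le_sub_one_of_pos (show 0 < Real.exp (-3) / x by positivity)
    rw [Real.log_div (Real.exp_pos _).ne' h0.ne', Real.log_exp] at h
    have he : Real.exp (-3) ≤ 1 / 20 := by
      have : Real.exp (-3) = Real.exp (-1) ^ 3 := by rw [← Real.exp_nat_mul]; norm_num
      rw [this]
      calc Real.exp (-1) ^ 3 ≤ 0.3678794412 ^ 3 := by
            gcongr; exact Real.exp_neg_one_lt_d9.le
        _ ≤ 1 / 20 := by norm_num
    have : Real.exp (-3) / x ≤ 1 / 20 / x := by gcongr
    linarith
  have b1 := mul_le_mul_of_nonneg_left a1 (show 0 ≤ 1 - x by linarith)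
  have b2 := mul_le_mul_of_nonneg_left a2 (show 0 ≤ 1 - 2 * x by linarith)
  rw [mul_div_cancel₀ _ (show 1 - 2 * x ≠ 0 by linarith)] at b2
  have b3 := mul_le_mul_of_nonneg_left a3 h0.le
  have e3 : x * (1 / 20 / x + 2) = 1 / 20 + 2 * x := by field_simp
  rw [e3] at b3
  have b4 := mul_le_mul_of_nonneg_left Real.log_two_gt_d9.le h0.le
  have b5 := mul_lt_mul_of_pos_left h1 h0
  nlinarith

lemma bConst_le {ε : ℝ} (h0 : 0 < ε) (h1 : ε < 1 / 2) : bConst ε ≤ 7 / 100 := by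
  set x := 1 / 8 - ε / 4 with hx
  have e1 : 1 / 4 - ε / 2 = 2 * x := by rw [hx]; ring
  have e2 : ε = 1 / 2 - 4 * x := by rw [hx]; ring
  have hx0 : 0 < x := by rw [hx]; linarith
  have hx1 : x < 1 / 8 := by rw [hx]; linarith
  have h := binEntropy_two_mul_sub_le hx0 hx1
  have hl := Real.log_two_gt_d9
  rw [bConst, e1, ← hx, binEntropy₂_eq_div, binEntropy₂_eq_div, ← sub_div, mul_div_assoc',
    div_le_iff₀ (by linarith)]
  have h2 := mul_le_mul_of_nonneg_left h h0.le
  -- A quadratic in `x` with maximum 9/200 at `x = 1/20`.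
  have h3 : ε * (1 / 20 + 2 * x) ≤ 9 / 200 := by
    rw [e2]; nlinarith [sq_nonneg (x - 1 / 20)]
  linarith

lemma bConst_nonneg {ε : ℝ} (h0 : 0 < ε) (h1 : ε < 1 / 2) : 0 ≤ bConst ε := by
  have h := Real.binEntropy_strictMonoOn.monotoneOn (a := 1 / 8 - ε / 4) (b := 1 / 4 - ε / 2)
    ⟨by linarith, by norm_num; linarith⟩ ⟨by linarith, by norm_num; linarith⟩ (by linarith)
  rw [bConst, binEntropy₂_eq_div, binEntropy₂_eq_div, ← sub_div]
  exact mul_nonneg h0.le (div_nonneg (by linarith) (Real.log_nonneg (by norm_num)))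

lemma mul_log_sub_eq {a b : ℝ} (ha : 0 < a) (hb : 0 < b) :
    (a + b) * Real.log (a + b) - a * Real.log a - b * Real.log b
      = (a + b) * Real.binEntropy (a / (a + b)) := by
  have hab : a + b ≠ 0 := by positivity
  have e : 1 - a / (a + b) = b / (a + b) := by field_simp; ring
  rw [binEntropy_eq_neg, e, Real.log_div ha.ne' hab, Real.log_div hb.ne' hab]
  field_simp
  ring

end Scalar

/-! ### Extractors and the decision tree -/

section Extractor

variable {X Y : Type*} [Fintype X] [Fintype Y]

/-- The elements of `S` whose bit `h (·, y)` is `b`. -/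
def fiber (h : X × Y → Bool) (S : Finset X) (y : Y) (b : Bool) : Finset X :=
  S.filter fun x => h (x, y) = b

omit [Fintype X] [Fintype Y] in
lemma card_fiber_add (h : X × Y → Bool) (S : Finset X) (y : Y) :
    (fiber h S y false).card + (fiber h S y true).card = S.card := by
  classical
  rw [fiber, fiber, ← Finset.card_filter_add_card_filter_not (s := S) (fun x => h (x, y) = false)]
  simp

omit [Fintype X] [Fintype Y] in
lemma sum_fiber_add (h : X × Y → Bool) (S : Finset X) (y : Y) {M : Type*} [AddCommMonoid M]
    (f : X → M) :
    ∑ x ∈ fiber h S y false, f x + ∑ x ∈ fiber h S y true, f x = ∑ x ∈ S, f x := by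
  classical
  rw [fiber, fiber, ← Finset.sum_filter_add_sum_filter_not S (fun x => h (x, y) = false)]
  simp

/-- An extractor splits sets of size at least `2 ^ k` evenly, on average over the seed. -/
lemma IsStrongExtractor.lt_sum_min [Nonempty Y] {k ε : ℝ} {h : X × Y → Bool}
    (hext : IsStrongExtractor k ε h) {S : Finset X} (hS : S.Nonempty)
    (hk : (2 : ℝ) ^ k ≤ S.card) :
    (1 / 2 - ε) * (S.card * Fintype.card Y)
      < ∑ y, min ((fiber h S y false).card : ℝ) (fiber h S y true).card := by
  classical
  have hs : (0 : ℝ) < S.card := by exact_mod_cast hS.card_pos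
  have hY : (0 : ℝ) < Fintype.card Y := by exact_mod_cast Fintype.card_pos
  set s : ℝ := (S.card : ℝ) with hs_def
  set N : ℝ := (Fintype.card Y : ℝ) with hN
  -- The flat distribution on `S`, of min-entropy `log₂ |S| ≥ k`.
  set p : X → ℝ := fun x => if x ∈ S then s⁻¹ else 0 with hp
  have hsum : ∀ y b, outputDist h (fun xy => p xy.1 * N⁻¹) (b, y)
      = (fiber h S y b).card / (s * N) := by
    intro y b
    simp only [outputDist, hp, fiber]
    rw [← Finset.sum_filter, Finset.card_filter, Nat.cast_sum, Finset.sum_div, Finset.sum_filter]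
    rw [← Finset.sum_subset (Finset.subset_univ S)]
    · refine Finset.sum_congr rfl fun x hx => ?_
      simp only [hx, if_true]
      split_ifs <;> simp [mul_comm]
    · intro x _ hx
      simp [hx]
  have hmem : p ∈ stdSimplex ℝ X := by
    refine ⟨fun x => ?_, ?_⟩
    · simp only [hp]; split_ifs <;> positivity
    · simp only [hp]
      rw [Finset.sum_ite_mem, Finset.univ_inter, Finset.sum_const, nsmul_eq_mul]
      exact mul_inv_cancel₀ hs.ne'
  have hmin : k ≤ minEntropy p := by
    have hsup : ⨆ x, p x = s⁻¹ := by
      obtain ⟨x0, hx0⟩ := hS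
      have : Nonempty X := ⟨x0⟩
      apply le_antisymm
      · refine ciSup_le fun x => ?_
        simp only [hp]; split_ifs
        · exact le_rfl
        · positivity
      · have := le_ciSup (Set.finite_range p).bddAbove x0
        simpa [hp, hx0] using this
    rw [minEntropy, hsup, Real.logb_inv, neg_neg, Real.le_logb_iff_rpow_le (by norm_num) hs]
    exact hk
  have hlt := hext p hmem hmin
  rw [Fintype.sum_prod_type_right] at hlt
  simp only [Fintype.sum_bool, ← hN, hsum] at hlt
  have hy : ∀ y, |(fiber h S y true).card / (s * N) - 1 / 2 * N⁻¹|
      + |(fiber h S y false).card / (s * N) - 1 / 2 * N⁻¹|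
      = N⁻¹ - 2 / (s * N) * min ((fiber h S y false).card : ℝ) (fiber h S y true).card := by
    intro y
    have hc : ((fiber h S y false).card : ℝ) + (fiber h S y true).card = s := by
      rw [hs_def]
      exact_mod_cast card_fiber_add h S y
    generalize ((fiber h S y false).card : ℝ) = a at *
    generalize ((fiber h S y true).card : ℝ) = b at *
    have e1 : b / (s * N) - 1 / 2 * N⁻¹ = (b - a) * (1 / (2 * (s * N))) := by
      rw [← hc] at hs ⊢; field_simp; ring
    have e2 : a / (s * N) - 1 / 2 * N⁻¹ = (a - b) * (1 / (2 * (s * N))) := by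
      rw [← hc] at hs ⊢; field_simp; ring
    have hpos : 0 ≤ 1 / (2 * (s * N)) := by positivity
    rw [e1, e2, abs_mul, abs_mul, abs_of_nonneg hpos, abs_sub_comm b a]
    rcases le_total a b with hab | hab
    · rw [min_eq_left hab, abs_of_nonpos (by linarith)]
      rw [← hc] at hs ⊢; field_simp; ring
    · rw [min_eq_right hab, abs_of_nonneg (by linarith)]
      rw [← hc] at hs ⊢; field_simp; ring
  simp only [hy] at hlt
  rw [Finset.sum_sub_distrib, ← Finset.mul_sum, Finset.sum_const, Finset.card_univ, nsmul_eq_mul,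
    ← hN, mul_inv_cancel₀ hY.ne'] at hlt
  have h2 : (1 - 2 * ε) / 2 * (s * N) < (2 / (s * N) *
      ∑ y, min ((fiber h S y false).card : ℝ) (fiber h S y true).card) / 2 * (s * N) := by
    gcongr; linarith
  have e3 : ∀ t : ℝ, (2 / (s * N) * t) / 2 * (s * N) = t := by
    intro t; field_simp
  rw [e3] at h2
  linarith

/-- A seed for which the extractor splits `S` evenly while the guess of the bit has small error. -/
lemma IsStrongExtractor.exists_seed [Nonempty Y] {k ε : ℝ} {h : X × Y → Bool}
    (hext : IsStrongExtractor k ε h) {S : Finset X} (hS : S.Nonempty)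
    (hk : (2 : ℝ) ^ k ≤ S.card) {err : Y → ℝ} (herr : ∀ y, 0 ≤ err y) {δ : ℝ} (hδ : 0 < δ)
    (hsum : ∑ y, err y ≤ (1 / 2 - ε) * δ * (S.card * Fintype.card Y)) :
    ∃ y, (1 / 2 - ε) / 2 * S.card ≤ min ((fiber h S y false).card : ℝ) (fiber h S y true).card
      ∧ err y ≤ δ * S.card := by
  by_contra! hcon
  have hlt := hext.lt_sum_min hS hk
  have hs : (0 : ℝ) < S.card := by exact_mod_cast hS.card_pos
  set g := 1 / 2 - ε with hg
  -- A seed with an even split has error above `δ |S|`, so its minimum, at most `|S| / 2`, is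
  -- charged to the error.
  have hpt : ∀ y, min ((fiber h S y false).card : ℝ) (fiber h S y true).card
      ≤ g / 2 * S.card + err y / (2 * δ) := by
    intro y
    by_cases hy : g / 2 * S.card ≤ min ((fiber h S y false).card : ℝ) (fiber h S y true).card
    · have h1 := hcon y hy
      have hc : ((fiber h S y false).card : ℝ) + (fiber h S y true).card = S.card := by
        exact_mod_cast card_fiber_add h S y
      have h2 : (S.card : ℝ) / 2 ≤ err y / (2 * δ) := by
        rw [div_le_div_iff₀ (by norm_num) (by positivity)]
        linarith
      -- Nonnegativity of `g` is forced by `hsum`, as the errors are nonnegative.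
      have h3 : 0 ≤ g / 2 * S.card := by
        have h4 : g * (S.card * Fintype.card Y) < S.card * Fintype.card Y / 2 := by
          refine hlt.trans_le ?_
          calc _ ≤ ∑ y : Y, (S.card : ℝ) / 2 := Finset.sum_le_sum fun y _ => by
                have hc : ((fiber h S y false).card : ℝ) + (fiber h S y true).card = S.card := by
                  exact_mod_cast card_fiber_add h S y
                linarith [min_le_left ((fiber h S y false).card : ℝ) (fiber h S y true).card,
                  min_le_right ((fiber h S y false).card : ℝ) (fiber h S y true).card]
            _ = _ := by rw [Finset.sum_const, Finset.card_univ, nsmul_eq_mul]; ring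
        have h5 : 0 ≤ g * δ * (S.card * Fintype.card Y) :=
          (Finset.sum_nonneg fun y _ => herr y).trans hsum
        have h6 : (0 : ℝ) < δ * (S.card * Fintype.card Y) := by
          have : (0 : ℝ) < Fintype.card Y := by exact_mod_cast Fintype.card_pos
          positivity
        have h7 : 0 ≤ g := by
          by_contra! hneg
          nlinarith
        positivity
      linarith [min_le_left ((fiber h S y false).card : ℝ) (fiber h S y true).card,
        min_le_right ((fiber h S y false).card : ℝ) (fiber h S y true).card]
    · have := herr y
      have : 0 ≤ err y / (2 * δ) := by positivity
      linarith
  have h1 := Finset.sum_le_sum fun y (_ : y ∈ Finset.univ) => hpt y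
  rw [Finset.sum_add_distrib, Finset.sum_const, Finset.card_univ, nsmul_eq_mul, ← Finset.sum_div]
    at h1
  have h2 : (∑ y, err y) / (2 * δ) ≤ g / 2 * (S.card * Fintype.card Y) := by
    rw [div_le_iff₀ (by positivity)]
    linarith
  linarith

/-- Superadditivity along a decision tree of extractor bits: a set function `G` that gains the
entropy of every bit, up to the error of guessing the bit, is large. -/
lemma IsStrongExtractor.le_of_split [Nonempty Y] {k ε : ℝ} {h : X × Y → Bool}
    (hext : IsStrongExtractor k ε h) (hε : 0 < ε) (hε' : ε < 1 / 2) {G : Finset X → ℝ}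
    {err : Y → X → ℝ} (herr : ∀ y x, 0 ≤ err y x) (hG : ∀ S, 0 ≤ G S)
    (hsplit : ∀ S y, G (fiber h S y false) + G (fiber h S y true)
        + ((S.card : ℝ) * Real.log S.card
          - (fiber h S y false).card * Real.log (fiber h S y false).card
          - (fiber h S y true).card * Real.log (fiber h S y true).card)
        - 2 * √(S.card * ∑ x ∈ S, err y x) ≤ G S)
    {L : ℝ} (hL : Real.log (Fintype.card X) ≤ L) (hkL : k * Real.log 2 ≤ L) {θ : ℝ}
    (hθ : θ = (1 / 2 - ε) * (11 / 25 * (1 / 2 - ε)) ^ 2) (S : Finset X) :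
    1 / 5 * (S.card * Real.log S.card - S.card * (k * Real.log 2))
      - 1 / 5 * (L - k * Real.log 2) * ((∑ x ∈ S, ∑ y, err y x) / (Fintype.card Y * θ)) ≤ G S := by
  have hY : (0 : ℝ) < Fintype.card Y := by exact_mod_cast Fintype.card_pos
  set g := 1 / 2 - ε with hg
  have hg0 : 0 < g := by rw [hg]; linarith
  have hθ0 : 0 < θ := by rw [hθ]; positivity
  set κ := k * Real.log 2 with hκ
  have hE : ∀ S : Finset X, 0 ≤ ∑ x ∈ S, ∑ y, err y x := fun S =>
    Finset.sum_nonneg fun x _ => Finset.sum_nonneg fun y _ => herr y x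
  induction S using Finset.strongInduction with
  | H S ih =>
    have hES := hE S
    have hES' : 0 ≤ 1 / 5 * (L - κ) * ((∑ x ∈ S, ∑ y, err y x) / (Fintype.card Y * θ)) :=
      mul_nonneg (mul_nonneg (by norm_num) (by linarith)) (by positivity)
    rcases S.eq_empty_or_nonempty with rfl | hS
    · simpa using hG ∅
    have hs : (0 : ℝ) < S.card := by exact_mod_cast hS.card_pos
    by_cases hk : (2 : ℝ) ^ k ≤ S.card
    swap
    · have h1 : Real.log S.card ≤ κ := by
        rw [hκ, ← Real.log_rpow (by norm_num)]
        exact Real.log_le_log hs (not_le.mp hk).le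
      have h2 := mul_le_mul_of_nonneg_left h1 hs.le
      linarith [hG S]
    -- On a set with large error the penalty alone cancels the main term, since `log |S| ≤ L`; then
    -- `G S ≥ 0` suffices.
    by_cases hbad : θ * (S.card * Fintype.card Y) < ∑ x ∈ S, ∑ y, err y x
    · have h1 : Real.log S.card ≤ L :=
        (Real.log_le_log hs (by exact_mod_cast Finset.card_le_univ S)).trans hL
      have h2 : (S.card : ℝ) ≤ (∑ x ∈ S, ∑ y, err y x) / (Fintype.card Y * θ) := by
        rw [le_div_iff₀ (by positivity)]
        linarith
      have h3 := mul_le_mul_of_nonneg_left h2 (show 0 ≤ L - κ by linarith)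
      have h4 := mul_le_mul_of_nonneg_left h1 hs.le
      linarith [hG S]
    -- With this `δ`, `θ = g δ`, and the Fano loss is at most `2 · (11/25) g |S| = (22/25) g |S|`.
    -- This is 4/5 of the lower bound `(11/10) g |S|` on the bit's entropy, so one fifth of that
    -- entropy remains.
    obtain ⟨y, hy1, hy2⟩ := hext.exists_seed hS hk (err := fun y => ∑ x ∈ S, err y x)
      (fun y => Finset.sum_nonneg fun x _ => herr y x) (δ := (11 / 25 * g) ^ 2) (by positivity)
      (by rw [Finset.sum_comm, ← hg, ← hθ]; exact not_lt.mp hbad)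
    rw [← hg] at hy1
    have hc : ((fiber h S y false).card : ℝ) + (fiber h S y true).card = S.card := by
      exact_mod_cast card_fiber_add h S y
    have hmin : 0 < min ((fiber h S y false).card : ℝ) (fiber h S y true).card :=
      lt_of_lt_of_le (by positivity) hy1
    have h0 : (0 : ℝ) < (fiber h S y false).card := hmin.trans_le (min_le_left _ _)
    have h1 : (0 : ℝ) < (fiber h S y true).card := hmin.trans_le (min_le_right _ _)
    have hss : ∀ b, fiber h S y b ⊂ S := by
      intro b
      refine (Finset.filter_subset _ _).ssubset_of_ne fun heq => ?_
      have heq' : ((fiber h S y b).card : ℝ) = S.card := by rw [fiber, heq]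
      cases b <;> linarith
    have ih0 := ih _ (hss false)
    have ih1 := ih _ (hss true)
    have hsp := hsplit S y
    have herrsum := sum_fiber_add h S y fun x => ∑ y, err y x
    have hent : 11 / 10 * g * S.card ≤ (S.card : ℝ) * Real.log S.card
          - (fiber h S y false).card * Real.log (fiber h S y false).card
          - (fiber h S y true).card * Real.log (fiber h S y true).card := by
      have hgoal : ∀ a b : ℝ, 0 < a → 0 < b → a + b = S.card → a ≤ b → g / 2 * S.card ≤ a →
          11 / 10 * g * S.card ≤ (S.card : ℝ) * Real.log S.card - a * Real.log a
            - b * Real.log b := by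
        intro a b ha hb hab hle hga
        have hent := mul_le_binEntropy_of_le (p := a / S.card) hg0 (by rw [hg]; linarith)
          (by rw [le_div_iff₀ hs]; exact hga) (by rw [div_le_iff₀ hs]; linarith)
        have := mul_log_sub_eq ha hb
        rw [hab] at this
        rw [this, mul_comm]
        exact mul_le_mul_of_nonneg_left hent hs.le
      rcases le_total ((fiber h S y false).card : ℝ) (fiber h S y true).card with hle | hle
      · exact hgoal _ _ h0 h1 hc hle (by rwa [min_eq_left hle] at hy1)
      · have := hgoal _ _ h1 h0 (by rw [add_comm]; exact hc) hle (by rwa [min_eq_right hle] at hy1)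
        linarith
    have hsqrt : √(S.card * ∑ x ∈ S, err y x) ≤ 11 / 25 * g * S.card := by
      rw [← Real.sqrt_sq (show 0 ≤ 11 / 25 * g * S.card by positivity)]
      apply Real.sqrt_le_sqrt
      have := mul_le_mul_of_nonneg_left hy2 hs.le
      linarith
    have hEeq : (∑ x ∈ S, ∑ y, err y x) / (Fintype.card Y * θ)
        = (∑ x ∈ fiber h S y false, ∑ y, err y x) / (Fintype.card Y * θ)
          + (∑ x ∈ fiber h S y true, ∑ y, err y x) / (Fintype.card Y * θ) := by
      rw [← add_div, herrsum]
    have hκ' : (S.card : ℝ) * κ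
        = (fiber h S y false).card * κ + (fiber h S y true).card * κ := by rw [← hc]; ring
    rw [hEeq, mul_add]
    linarith

end Extractor

/-! ### Information carried by an ensemble with guessable bits -/

section Ensemble

variable {X Y D : Type*} [Fintype X] [Fintype Y] [Fintype D] [DecidableEq D]

/-- The error of guessing the bit `h (X, y)` of an ensemble by the measurement `E`, `1 - E`. -/
noncomputable def guessError (h : X × Y → Bool) (σ : X → Matrix D D ℂ) (E : Matrix D D ℂ) (y : Y)
    (x : X) : ℝ :=
  if h (x, y) then (E * σ x).trace.re else ((1 - E) * σ x).trace.re

omit [Fintype X] [Fintype Y] in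
lemma sum_guessError (h : X × Y → Bool) (σ : X → Matrix D D ℂ) (E : Matrix D D ℂ) (y : Y)
    (S : Finset X) :
    ∑ x ∈ S, guessError h σ E y x = ((1 - E) * ∑ x ∈ fiber h S y false, σ x).trace.re
      + (E * ∑ x ∈ fiber h S y true, σ x).trace.re := by
  rw [← sum_fiber_add h S y, Matrix.mul_sum, Matrix.mul_sum, Matrix.trace_sum, Matrix.trace_sum,
    Complex.re_sum, Complex.re_sum]
  congr 1 <;> refine Finset.sum_congr rfl fun x hx => ?_ <;>
    simp [guessError, (Finset.mem_filter.mp hx).2]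

lemma vonNeumann_sub_sum_nonneg {σ : X → Matrix D D ℂ} (hσ : ∀ x, (σ x).PosSemidef)
    (htr : (∑ x, σ x).trace.re = 1) :
    0 ≤ vonNeumann (∑ x, σ x) - ∑ x, vonNeumann (σ x) + Real.log (Fintype.card X) := by
  have := sum_vonNeumann_le hσ Finset.univ
  rw [htr, Finset.card_univ] at this
  linarith

/-- If the bits of an extractor can be guessed well from an ensemble, then the ensemble carries
much information. -/
lemma IsStrongExtractor.le_vonNeumann_sub_sum [Nonempty X] [Nonempty Y] {k ε : ℝ}
    {h : X × Y → Bool}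
    (hext : IsStrongExtractor k ε h) (hε : 0 < ε) (hε' : ε < 1 / 2)
    {σ : X → Matrix D D ℂ} (hσ : ∀ x, (σ x).PosSemidef)
    (htr : ∀ x, (σ x).trace.re = (Fintype.card X : ℝ)⁻¹) {E : Y → Matrix D D ℂ}
    (hE : ∀ y, (E y).IsHermitian) (hEE : ∀ y, E y * E y = E y)
    (herr : ∑ y, ∑ x, guessError h σ (E y) y x ≤ (1 / 2 - ε) ^ 3 / 8 * Fintype.card Y)
    (hk : k * Real.log 2 ≤ Real.log (Fintype.card X)) :
    7 / 100 * (Real.log (Fintype.card X) - k * Real.log 2)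
      ≤ vonNeumann (∑ x, σ x) - ∑ x, vonNeumann (σ x) + Real.log (Fintype.card X) := by
  have hN : (0 : ℝ) < Fintype.card X := by exact_mod_cast Fintype.card_pos
  have hY : (0 : ℝ) < Fintype.card Y := by exact_mod_cast Fintype.card_pos
  set N : ℝ := (Fintype.card X : ℝ) with hNdef
  have htrS : ∀ S : Finset X, (∑ x ∈ S, σ x).trace.re = S.card / N := by
    intro S
    rw [Matrix.trace_sum, Complex.re_sum, Finset.sum_congr rfl fun x _ => htr x,
      Finset.sum_const, nsmul_eq_mul, div_eq_mul_inv]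
  have hposE := fun y => posSemidef_of_projection (hE y) (hEE y)
  have hposF := fun y => posSemidef_one_sub_of_projection (hE y) (hEE y)
  have hge0 : ∀ y x, 0 ≤ guessError h σ (E y) y x := by
    intro y x
    rw [guessError]
    split_ifs
    · exact trace_mul_nonneg (hposE y) (hσ x)
    · exact trace_mul_nonneg (hposF y) (hσ x)
  -- Here `G S` is `|S|` times the Holevo information of the normalized states `N σ x`, `x` uniform
  -- in `S`; the term `|S| log |S|` comes from the normalization.
  have key := hext.le_of_split hε hε'
    (G := fun S => N * (vonNeumann (∑ x ∈ S, σ x) - ∑ x ∈ S, vonNeumann (σ x))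
      + S.card * Real.log S.card)
    (err := fun y x => N * guessError h σ (E y) y x)
    (fun y x => mul_nonneg hN.le (hge0 y x)) ?_ ?_ le_rfl hk rfl Finset.univ
  · simp only [Finset.card_univ, ← hNdef] at key
    rw [Finset.sum_comm] at key
    simp only [← Finset.mul_sum] at key
    set g := 1 / 2 - ε with hg
    have hg0 : 0 < g := by rw [hg]; linarith
    set κ := k * Real.log 2
    -- The ratio of `g³/8` to `θ = (121/625) g³` is below 13/20, and `(1/5)(1 - 13/20) = 7/100`.
    have h1 : (N * ∑ y, ∑ x, guessError h σ (E y) y x)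
        / (Fintype.card Y * (g * (11 / 25 * g) ^ 2)) ≤ N * (13 / 20) := by
      rw [div_le_iff₀ (by positivity)]
      have h2 : g ^ 3 / 8 * Fintype.card Y
          ≤ 13 / 20 * (Fintype.card Y * (g * (11 / 25 * g) ^ 2)) := by
        have : 0 < g ^ 3 * Fintype.card Y := by positivity
        linarith
      have := mul_le_mul_of_nonneg_left (herr.trans h2) hN.le
      linarith
    have h3 := mul_le_mul_of_nonneg_left h1 (show 0 ≤ Real.log N - κ by linarith)
    refine le_of_mul_le_mul_left ?_ hN
    linarith
  · intro S
    have h1 := sum_vonNeumann_le hσ S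
    rw [htrS] at h1
    have h2 := mul_le_mul_of_nonneg_left h1 hN.le
    have h3 : N * (S.card / N * Real.log S.card) = S.card * Real.log S.card := by field_simp
    linarith
  · intro S y
    have hA := Matrix.posSemidef_sum (fiber h S y false) fun x _ => hσ x
    have hB := Matrix.posSemidef_sum (fiber h S y true) fun x _ => hσ x
    have h1 := vonNeumann_add_sub_le hA hB (hE y) (hEE y)
    rw [← sum_guessError, sum_fiber_add, htrS] at h1
    have h2 := mul_le_mul_of_nonneg_left h1 hN.le
    have h3 := sum_fiber_add h S y fun x => vonNeumann (σ x)
    have h4 : √(S.card * ∑ x ∈ S, N * guessError h σ (E y) y x)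
        = N * √(S.card / N * ∑ x ∈ S, guessError h σ (E y) y x) := by
      rw [← Finset.mul_sum]
      nth_rewrite 2 [← Real.sqrt_sq hN.le]
      rw [← Real.sqrt_mul (sq_nonneg N)]
      congr 1
      field_simp
    rw [h4, ← h3]
    linarith

end Ensemble

/-! ### Classical-quantum states, mutual information and trace distance -/

section States

variable {X Y D : Type*} [Fintype X] [Fintype Y] [Fintype D] [DecidableEq X] [DecidableEq Y]
  [DecidableEq D]

lemma traceNorm_blocks {o ι : Type*} [Fintype o] [Fintype ι] [DecidableEq ι]
    [DecidableEq o] (e : o × D ≃ ι) {M : Matrix ι ι ℂ} {N : o → Matrix D D ℂ}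
    (hM : ∀ i d j d', M (e (i, d)) (e (j, d')) = if i = j then N i d d' else 0) :
    traceNorm M = ∑ i, traceNorm (N i) := by
  simp only [traceNorm]
  rw [trace_cfc_blocks e (N := fun i => (N i)ᴴ * N i)
    (fun i => Matrix.isHermitian_conjTranspose_mul_self (N i)) _ Real.sqrt, Complex.re_sum]
  intro i d j d'
  rw [Matrix.mul_apply, ← e.sum_comp, Fintype.sum_prod_type]
  simp only [Matrix.conjTranspose_apply, hM]
  by_cases hij : i = j
  · subst hij
    rw [Finset.sum_eq_single i (fun l _ hl => by simp [hl]) (by simp)]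
    simp [Matrix.mul_apply]
  · rw [if_neg hij]
    refine Finset.sum_eq_zero fun l _ => Finset.sum_eq_zero fun c _ => ?_
    by_cases hl : l = i
    · subst hl; simp [hij]
    · simp [hl]

lemma traceNorm_neg (M : Matrix D D ℂ) : traceNorm (-M) = traceNorm M := by
  simp [traceNorm]

lemma vonNeumann_uniformState [Nonempty X] :
    vonNeumann (uniformState X) = Real.log (Fintype.card X) := by
  have h : uniformState X
      = algebraMap ℝ (Matrix X X ℂ) (Fintype.card X : ℝ)⁻¹ := by
    rw [uniformState, Matrix.algebraMap_eq_diagonal]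
    congr 1
    funext x
    simp
  have hN : (Fintype.card X : ℝ) ≠ 0 := by exact_mod_cast Fintype.card_ne_zero
  rw [vonNeumann, h, cfc_algebraMap, Matrix.algebraMap_eq_diagonal, Matrix.trace_diagonal]
  simp only [Pi.algebraMap_apply, Complex.coe_algebraMap, Finset.sum_const, Finset.card_univ,
    nsmul_eq_mul, Real.negMulLog, Real.log_inv, ← Complex.ofReal_natCast, ← Complex.ofReal_mul,
    Complex.ofReal_re]
  field_simp

/-- The blocks `⟨x| τ |x⟩` of a classical-quantum state. -/
def block (τ : Matrix (X × D) (X × D) ℂ) (x : X) : Matrix D D ℂ :=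
  τ.submatrix (fun d => (x, d)) (fun d => (x, d))

omit [Fintype D] [DecidableEq X] [DecidableEq D] in
lemma traceFst_eq_sum_block (τ : Matrix (X × D) (X × D) ℂ) : traceFst τ = ∑ x, block τ x := by
  ext d d'
  simp [traceFst, block, Matrix.sum_apply]

lemma mutualInfo_eq [Nonempty X] {τ : Matrix (X × D) (X × D) ℂ} (hτ : τ.PosSemidef)
    (hcl : ∀ x d x' d', x ≠ x' → τ (x, d) (x', d') = 0) (hX : traceSnd τ = uniformState X) :
    mutualInfo τ * Real.log 2 = vonNeumann (∑ x, block τ x) - ∑ x, vonNeumann (block τ x)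
      + Real.log (Fintype.card X) := by
  have hb : ∀ x, (block τ x).PosSemidef := fun x => hτ.submatrix _
  have hu : (uniformState X).IsHermitian := by
    rw [uniformState, Matrix.isHermitian_diagonal_iff]
    intro i
    simp [IsSelfAdjoint]
  have hblocks : vonNeumann τ = ∑ x, vonNeumann (block τ x) := by
    simp only [vonNeumann]
    rw [trace_cfc_blocks (Equiv.refl (X × D)) (fun x => (hb x).isHermitian) _ _, Complex.re_sum]
    intro x d x' d'
    by_cases hx : x = x'
    · subst hx; simp [block]
    · simp [hx, hcl]
  have hl : Real.log 2 ≠ 0 := (Real.log_pos (by norm_num)).ne'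
  rw [mutualInfo, hX, traceFst_eq_sum_block, entropy_eq_vonNeumann_div hu,
    entropy_eq_vonNeumann_div hτ.isHermitian,
    entropy_eq_vonNeumann_div (Matrix.posSemidef_sum _ fun x _ => hb x).isHermitian, hblocks,
    vonNeumann_uniformState]
  field_simp
  ring

omit [DecidableEq X] in
/-- The trace distance from uniform is governed by the errors of optimal guesses of the bits. -/
lemma exists_traceNorm_outputState_eq [Nonempty Y] (h : X × Y → Bool)
    {ρ : Matrix (Y × X × D) (Y × X × D) ℂ} {τ : Matrix (X × D) (X × D) ℂ}
    (hρ : ρ = uniformState Y ⊗ₖ τ) (hτ : ∀ x, (block τ x).IsHermitian)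
    (htr : (∑ x, block τ x).trace.re = 1) :
    ∃ E : Y → Matrix D D ℂ, (∀ y, (E y).IsHermitian) ∧ (∀ y, E y * E y = E y) ∧
      traceNorm (outputState h ρ - uniformState Bool ⊗ₖ stateYM ρ)
        = 1 - 2 * (∑ y, ∑ x, guessError h (block τ) (E y) y x) / Fintype.card Y := by
  set A : Y → Bool → Matrix D D ℂ := fun y b => ∑ x ∈ fiber h Finset.univ y b, block τ x with hA
  -- Subtracting the average of `A y false` and `A y true` leaves half their difference, up to sign,
  -- in each block; the seed probability supplies the other factor.
  set c : ℝ := (2 * (Fintype.card Y : ℝ))⁻¹ with hc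
  set T : Y → Matrix D D ℂ := fun y => c • (A y false - A y true) with hT
  have hAH : ∀ y b, (A y b).IsHermitian := fun y b =>
    isSelfAdjoint_sum _ fun x _ => hτ x
  have hTH : ∀ y, (T y).IsHermitian := fun y => by
    rw [hT, Matrix.IsHermitian, Matrix.conjTranspose_smul, star_trivial,
      ((hAH y false).sub (hAH y true)).eq]
  choose E hE hEE hnorm using fun y => exists_projection_traceNorm (hTH y)
  refine ⟨E, hE, hEE, ?_⟩
  have hY : (Fintype.card Y : ℝ) ≠ 0 := by exact_mod_cast Fintype.card_ne_zero
  have hblocks : traceNorm (outputState h ρ - uniformState Bool ⊗ₖ stateYM ρ)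
      = ∑ p : Bool × Y, traceNorm (if p.1 then -T p.2 else T p.2) := by
    refine traceNorm_blocks (Equiv.prodAssoc Bool Y D) ?_
    rintro ⟨b, y⟩ d ⟨b', y'⟩ d'
    have hρ' : ∀ x, ρ (y, x, d) (y', x, d')
        = if y = y' then (Fintype.card Y : ℂ)⁻¹ * block τ x d d' else 0 := by
      intro x
      rw [hρ]
      simp [uniformState, Matrix.kroneckerMap_apply, Matrix.diagonal_apply, block]
    simp only [Equiv.prodAssoc_apply, Matrix.sub_apply, outputState, Matrix.of_apply,
      Matrix.kroneckerMap_apply, stateYM, hρ', uniformState, Matrix.diagonal_apply, Prod.mk.injEq,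
      Fintype.card_bool]
    by_cases hy : y = y'
    swap
    · simp [hy]
    subst hy
    by_cases hb : b = b'
    swap
    · simp only [hb, if_false, zero_mul, sub_zero, false_and]
      refine Finset.sum_eq_zero fun x _ => if_neg ?_
      rintro ⟨h1, h2⟩
      exact hb (h1.symm.trans h2)
    subst hb
    have hsum : ∀ b, ∑ x, (if h (x, y) = b then
        (Fintype.card Y : ℂ)⁻¹ * block τ x d d' else 0)
        = (Fintype.card Y : ℂ)⁻¹ * A y b d d' := by
      intro b
      rw [← Finset.sum_filter, ← Finset.mul_sum, hA]
      simp only [fiber, Matrix.sum_apply]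
    have hall : ∑ x, (Fintype.card Y : ℂ)⁻¹ * block τ x d d'
        = (Fintype.card Y : ℂ)⁻¹ * (A y false d d' + A y true d d') := by
      rw [← Finset.mul_sum, hA]
      simp only [Matrix.sum_apply]
      rw [sum_fiber_add]
    simp only [and_self, if_true, hsum, hall]
    cases b <;> simp [hT, hc, Matrix.smul_apply] <;> ring
  have hEy : ∀ y, traceNorm (T y) = c * (1 - 2 * ∑ x, guessError h (block τ) (E y) y x) := by
    intro y
    have h1 : ∀ F : Matrix D D ℂ, (F * T y).trace.re
        = c * ((F * A y false).trace.re - (F * A y true).trace.re) := by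
      intro F
      rw [hT]
      simp only [Matrix.mul_smul, Matrix.trace_smul, Complex.smul_re, Matrix.mul_sub,
        Matrix.trace_sub, Complex.sub_re, smul_eq_mul]
    have h2 : (E y * A y false).trace.re + (E y * A y true).trace.re
        + (((1 - E y) * A y false).trace.re + ((1 - E y) * A y true).trace.re) = 1 := by
      simp only [← Complex.add_re, ← Matrix.trace_add, ← Matrix.mul_add, ← Matrix.add_mul, hA]
      rw [sum_fiber_add, add_sub_cancel, one_mul, htr]
    rw [hnorm, h1, h1, sum_guessError]
    rw [← mul_sub]
    congr 1
    linarith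
  rw [hblocks, Fintype.sum_prod_type]
  simp only [Fintype.sum_bool, if_true, Bool.false_eq_true, if_false, traceNorm_neg, hEy]
  rw [← Finset.mul_sum, Finset.sum_sub_distrib, Finset.sum_const, Finset.card_univ,
    ← Finset.mul_sum, hc, nsmul_eq_mul]
  field_simp
  ring

end States

end QExtract

/-! ### The main theorem -/

theorem mainTheorem5 {D : Type*} [Fintype D] [DecidableEq D]
    (n m : ℕ) (k ε : ℝ) (hε : 0 < ε) (hε' : ε < 1 / 2)
    (h : QExtract.Bits n × QExtract.Bits m → Bool)
    (hext : QExtract.IsStrongExtractor k ε h)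
    (ρ : Matrix (QExtract.Bits m × QExtract.Bits n × D) (QExtract.Bits m × QExtract.Bits n × D) ℂ)
    (hρ : QExtract.IsState ρ)
    (hclassical : QExtract.IsClassicalYX ρ)
    (hX : QExtract.traceSnd (QExtract.traceFst ρ) = QExtract.uniformState (QExtract.Bits n))
    (hY : QExtract.traceSnd ρ = QExtract.uniformState (QExtract.Bits m))
    (hindep : ρ = QExtract.traceSnd ρ ⊗ₖ QExtract.traceFst ρ)
    (hinfo : QExtract.mutualInfo (QExtract.traceFst ρ) < QExtract.bConst ε * (n - k)) :
    QExtract.traceNorm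
        (QExtract.outputState h ρ - QExtract.uniformState Bool ⊗ₖ QExtract.stateYM ρ)
      < 1 - QExtract.aConst ε := by
  open QExtract in
  set τ := traceFst ρ with hτdef
  rw [hY] at hindep
  have hτeq : τ = ∑ y, ρ.submatrix (fun i => (y, i)) (fun i => (y, i)) := by
    ext i j
    simp [hτdef, traceFst, Matrix.sum_apply]
  have hτ : τ.PosSemidef := by
    rw [hτeq]
    exact Matrix.posSemidef_sum _ fun y _ => hρ.1.submatrix _
  have hcl : ∀ x d x' d', x ≠ x' → τ (x, d) (x', d') = 0 := by
    intro x d x' d' hx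
    rw [hτdef, traceFst, Matrix.of_apply]
    exact Finset.sum_eq_zero fun y _ => hclassical y x d y x' d' fun he => hx (Prod.mk.inj he).2
  have htr : ∀ x, (block τ x).trace.re = (Fintype.card (Bits n) : ℝ)⁻¹ := by
    intro x
    have h1 : (block τ x).trace = traceSnd τ x x := rfl
    rw [h1, hX, uniformState, Matrix.diagonal_apply_eq, ← Complex.ofReal_natCast,
      ← Complex.ofReal_inv, Complex.ofReal_re]
  have htr1 : (∑ x, block τ x).trace.re = 1 := by
    rw [Matrix.trace_sum, Complex.re_sum, Finset.sum_congr rfl fun x _ => htr x, Finset.sum_const,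
      Finset.card_univ, nsmul_eq_mul]
    exact mul_inv_cancel₀ (by exact_mod_cast Fintype.card_ne_zero)
  have hb : ∀ x, (block τ x).PosSemidef := fun x => hτ.submatrix _
  have hl : 0 < Real.log 2 := Real.log_pos (by norm_num)
  have hcard : Real.log (Fintype.card (Bits n)) = n * Real.log 2 := by
    simp [Bits, Real.log_pow]
  have hMI := mutualInfo_eq hτ hcl hX
  have hlt := mul_lt_mul_of_pos_right hinfo hl
  rw [hMI, hcard] at hlt
  have hb0 := bConst_nonneg hε hε'
  obtain ⟨E, hE, hEE, hnorm⟩ :=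
    exists_traceNorm_outputState_eq h hindep (fun x => (hb x).isHermitian) htr1
  rw [hnorm]
  by_contra! hcon
  have h0 := vonNeumann_sub_sum_nonneg hb htr1
  rw [hcard] at h0
  -- Otherwise the hypothesis would make the mutual information negative.
  have hkn : k < n := by
    by_contra! hkn
    have : bConst ε * (n - k) ≤ 0 := mul_nonpos_of_nonneg_of_nonpos hb0 (by linarith)
    have := mul_nonpos_of_nonpos_of_nonneg this hl.le
    linarith
  have hM : (0 : ℝ) < Fintype.card (Bits m) := by exact_mod_cast Fintype.card_pos
  -- The norm is `1 - 2 · (average error)`, so `hcon` bounds the average error by `a(ε)/2 = (1/2 -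
  -- ε)³/8`.
  have key := hext.le_vonNeumann_sub_sum hε hε' hb htr hE hEE (by
    rw [aConst] at hcon
    rw [← div_le_iff₀ hM]
    rw [mul_div_assoc] at hcon
    linarith) (by rw [hcard]; exact mul_le_mul_of_nonneg_right hkn.le hl.le)
  rw [hcard] at key
  have := mul_le_mul_of_nonneg_right (bConst_le hε hε')
    (mul_nonneg (show (0 : ℝ) ≤ n - k by linarith) hl.le)
  linarith
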